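/- Consider the $3$-uniform hypergraphs $\mathcal{T}=\{v_1v_2v_3,\,v_2v_3v_4,\,v_3v_4v_5\}$ (tight path), $\mathcal{M}=\{v_1v_2v_3,\,v_2v_3v_4,\,v_4v_5v_6\}$ (messy path) and $\mathcal{L}=\{v_1v_2v_3,\,v_3v_4v_5,\,v_5v_6v_7\}$ (loose path), where the $v_i$ are distinct vertices. Let $K^{(3)}_{n,n,n}$ be the complete $3$-partite $3$-uniform hypergraph whose three disjoint partite sets have $n$ vertices each and whose edges are all the $3$-element vertex sets that contain exactly one vertex of each partite set. For a $3$-uniform hypergraph $G$, let $ar(K^{(3)}_{n,n,n},G)$ be the minimum integer $k\ge 0$ such that every (not necessarily proper) edge-coloring of $K^{(3)}_{n,n,n}$ in which at least $k$ distinct colors occur contains a rainbow copy of $G$, that is, a copy of $G$ whose edges have pairwise distinct colors. Then for every integer $n\ge 3$, $$ar(K^{(3)}_{n,n,n},\mathcal{M})=n+1 \qquad\text{and}\qquad ar(K^{(3)}_{n,n,n},\mathcal{T})=ar(K^{(3)}_{n,n,n},\mathcal{L})=n+2.$$ -/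

import Mathlib

namespace AntiRamsey

/-- The complete `r`-partite `r`-uniform hypergraph `K^{(r)}_{n,…,n}`: the `i`-th partite set is
`{i} × Fin n`, and the edges are the `r`-element vertex sets that meet every partite set in exactly
one vertex. -/
def completePartite (r n : ℕ) : Hypergraph (Fin r × Fin n) where
  vertexSet := Set.univ
  edgeSet := {e | e.ncard = r ∧ ∀ i : Fin r, (e ∩ {v | v.1 = i}).ncard = 1}
  subset_vertexSet_of_mem_edgeSet' := fun e _ => Set.subset_univ e

/-- The tight path `𝒯 = {v₁v₂v₃, v₂v₃v₄, v₃v₄v₅}` (vertices numbered from `0`). -/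
def tightPath : Hypergraph (Fin 5) where
  vertexSet := Set.univ
  edgeSet := {{0, 1, 2}, {1, 2, 3}, {2, 3, 4}}
  subset_vertexSet_of_mem_edgeSet' := fun e _ => Set.subset_univ e

/-- The messy path `ℳ = {v₁v₂v₃, v₂v₃v₄, v₄v₅v₆}` (vertices numbered from `0`). -/
def messyPath : Hypergraph (Fin 6) where
  vertexSet := Set.univ
  edgeSet := {{0, 1, 2}, {1, 2, 3}, {3, 4, 5}}
  subset_vertexSet_of_mem_edgeSet' := fun e _ => Set.subset_univ e

/-- The loose path `ℒ = {v₁v₂v₃, v₃v₄v₅, v₅v₆v₇}` (vertices numbered from `0`). -/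
def loosePath : Hypergraph (Fin 7) where
  vertexSet := Set.univ
  edgeSet := {{0, 1, 2}, {2, 3, 4}, {4, 5, 6}}
  subset_vertexSet_of_mem_edgeSet' := fun e _ => Set.subset_univ e

/-- The edge-colouring `c` of `H` contains a rainbow copy of `G`: some injection `φ` of the vertices
of `G` into those of `H` sends every edge of `G` to an edge of `H`, and the edges of this copy
receive pairwise distinct colours. -/
def HasRainbowCopy {α β : Type*} (H : Hypergraph α) (c : H.edgeSet → ℕ) (G : Hypergraph β) :
    Prop :=
  ∃ φ : β → α, Set.MapsTo φ G.vertexSet H.vertexSet ∧ Set.InjOn φ G.vertexSet ∧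
    ∃ hφ : ∀ e ∈ G.edgeSet, φ '' e ∈ H.edgeSet,
      Function.Injective fun e : G.edgeSet => c ⟨φ '' e.1, hφ e.1 e.2⟩

/-- `k` is the anti-Ramsey number `ar(H, G)` of a hypergraph `H` with finitely many edges: the
least `k` such that every edge-colouring of `H` in which at least `k` colours occur contains a
rainbow copy of `G`. -/
def IsAntiRamseyNumber {α β : Type*} (H : Hypergraph α) (G : Hypergraph β) (k : ℕ) : Prop :=
  IsLeast {k : ℕ | ∀ c : H.edgeSet → ℕ, k ≤ (Set.range c).ncard → HasRainbowCopy H c G} k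

end AntiRamsey

/-! An edge of the host is a cell of the cube `Fin n × Fin n × Fin n`, so a colouring is a function
`f a b c`. A tight path is two perpendicular steps inside a plane; a messy path is one step along a
line followed by a change of both other coordinates; in a loose path, consecutive cells share
exactly one coordinate and the end cells share none. Each bound is the maximal number of colours
without rainbow copy, plus one.

Tight, at most `n + 1` colours: a plane with three colours makes `f` depend on one coordinate only.
Otherwise all planes have at most two colours, and once some plane shows `p` and `q`, each parallel
plane adds at most one more.

Messy, at most `n`: a line with three colours makes `f` depend on one coordinate only. Otherwise a
two-coloured line leaves room for only one further colour (`NoMessy.third_color_unique`), so at most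
`3 ≤ n` colours occur.

Loose, at most `n + 1`: no three pairwise far cells are rainbow (`NoLoose.not_rainbow_far`), hence
any two colour pairs occurring on far cells meet (`NoLoose.farPair_inter`). An intersecting family
of pairs that covers four colours is a star. All cells that avoid its centre then lie on one line.

Sharpness: colour by the vertex in one part (messy), or give distinct colours to a perfect matching
(tight) or to the edges through a fixed pair (loose), and one further colour to the rest. -/

namespace AntiRamsey

/-- Three colours are pairwise distinct. -/
def Rainbow (p q r : ℕ) : Prop := p ≠ q ∧ p ≠ r ∧ q ≠ r

/-! ### Counting colours -/

section Counting

variable {α : Type*}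

/-- The set of colours used by a colouring of the cells of a cube. -/
def colors (f : α → α → α → ℕ) : Set ℕ := {p | ∃ a b c, f a b c = p}

theorem colors_swap₁₂ (f : α → α → α → ℕ) : colors (fun b a c => f a b c) = colors f := by
  ext p
  exact ⟨fun ⟨b, a, c, h⟩ => ⟨a, b, c, h⟩, fun ⟨a, b, c, h⟩ => ⟨b, a, c, h⟩⟩

theorem colors_rotate (f : α → α → α → ℕ) : colors (fun c a b => f a b c) = colors f := by
  ext p
  exact ⟨fun ⟨c, a, b, h⟩ => ⟨a, b, c, h⟩, fun ⟨a, b, c, h⟩ => ⟨c, a, b, h⟩⟩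

theorem ncard_le_of_subset_range [Fintype α] {S : Set ℕ} (h : α → ℕ) (hS : S ⊆ Set.range h) :
    S.ncard ≤ Fintype.card α := by
  refine (Set.ncard_le_ncard hS (Set.finite_range h)).trans ?_
  rw [← Set.image_univ, ← Nat.card_eq_fintype_card, ← Set.ncard_univ]
  exact Set.ncard_image_le Set.finite_univ

theorem ncard_le_of_subset_insert_range [Fintype α] {S : Set ℕ} (p : ℕ) (h : α → ℕ)
    (hS : S ⊆ insert p (Set.range h)) : S.ncard ≤ Fintype.card α + 1 :=
  (Set.ncard_le_ncard hS ((Set.finite_range h).insert p)).trans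
    ((Set.ncard_insert_le p _).trans
      (Nat.add_le_add_right (ncard_le_of_subset_range h subset_rfl) 1))

theorem exists_mem_notMem_of_lt_ncard {S : Set ℕ} (l : Finset ℕ) (h : l.card < S.ncard) :
    ∃ p ∈ S, p ∉ l := by
  by_contra! hl
  have := Set.ncard_le_ncard (s := S) (t := l) (fun p hp => hl p hp) l.finite_toSet
  rw [Set.ncard_coe_finset] at this
  omega

end Counting

/-! ### Upper bound for the tight path -/

section Tight

variable {α : Type*}

/-- A coloured grid without two perpendicular steps through three distinct colours. -/
def NoCorner (g : α → α → ℕ) : Prop := ∀ a a' b b', ¬ Rainbow (g a b) (g a' b) (g a' b')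

/-- A coloured cube without rainbow tight path. -/
def NoTight (f : α → α → α → ℕ) : Prop :=
  (∀ c, NoCorner fun a b => f a b c) ∧ (∀ b, NoCorner fun a c => f a b c) ∧
    ∀ a, NoCorner fun b c => f a b c

theorem NoCorner.swap {g : α → α → ℕ} (hg : NoCorner g) : NoCorner fun b a => g a b := by
  intro b b' a a' h
  exact hg a' a b' b ⟨h.2.2.symm, h.2.1.symm, h.1.symm⟩

theorem NoTight.swap₁₂ {f : α → α → α → ℕ} (hf : NoTight f) :
    NoTight fun b a c => f a b c :=
  ⟨fun c => (hf.1 c).swap, hf.2.2, hf.2.1⟩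

theorem NoTight.rotate {f : α → α → α → ℕ} (hf : NoTight f) :
    NoTight fun c a b => f a b c :=
  ⟨fun b => (hf.2.1 b).swap, fun a => (hf.2.2 a).swap, hf.1⟩

/-- At least two of the three cells differ in colour from `(a, b)`, and the corners starting at them
leave only `g a b` for `(a, b')`. -/
theorem NoCorner.eq_of_rainbow_line {g : α → α → ℕ} (hg : NoCorner g) {a₁ a₂ a₃ b : α}
    (h : Rainbow (g a₁ b) (g a₂ b) (g a₃ b)) (a b' : α) : g a b' = g a b := by
  have h₁ := hg a₁ a b b'
  have h₂ := hg a₂ a b b'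
  have h₃ := hg a₃ a b b'
  unfold Rainbow at *
  grind

theorem NoCorner.lines_constant {g : α → α → ℕ} (hg : NoCorner g) {a₁ a₂ a₃ b₁ b₂ b₃ : α}
    (h : Rainbow (g a₁ b₁) (g a₂ b₂) (g a₃ b₃)) :
    (∀ a b b', g a b = g a b') ∨ ∀ a a' b, g a b = g a' b := by
  by_contra! H
  obtain ⟨⟨a, b, b', hb⟩, x, x', y, hx⟩ := H
  -- A third colour on the line at height `y` would make every perpendicular line constant, against
  -- `hb`.
  have two : ∀ z, g z y = g x y ∨ g z y = g x' y := by
    intro z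
    by_contra! hz
    have := hg.eq_of_rainbow_line (b := y) ⟨hx, hz.1.symm, hz.2.symm⟩
    exact hb ((this a b).trans (this a b').symm)
  have all : ∀ z w, g z w = g x y ∨ g z w = g x' y := by
    intro z w
    have h₁ := hg x z y w
    have h₂ := hg x' z y w
    have := two z
    unfold Rainbow at *
    grind
  have h₁ := all a₁ b₁
  have h₂ := all a₂ b₂
  have h₃ := all a₃ b₃
  unfold Rainbow at h
  grind

theorem NoTight.ncard_le_of_rainbow_plane [Fintype α] {f : α → α → α → ℕ} (hf : NoTight f)
    {a₁ a₂ a₃ b₁ b₂ b₃ c : α} (h : Rainbow (f a₁ b₁ c) (f a₂ b₂ c) (f a₃ b₃ c)) :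
    (colors f).ncard ≤ Fintype.card α := by
  rcases (hf.1 c).lines_constant h with H | H
  · refine ncard_le_of_subset_range (fun a => f a b₁ c) ?_
    rintro _ ⟨x, y, z, rfl⟩
    have h' : Rainbow (f a₁ y c) (f a₂ y c) (f a₃ y c) := by
      rwa [H a₁ y b₁, H a₂ y b₂, H a₃ y b₃]
    exact ⟨x, (H x b₁ y).trans ((hf.2.1 y).eq_of_rainbow_line (b := c) h' x z).symm⟩
  · refine ncard_le_of_subset_range (fun b => f a₁ b c) ?_
    rintro _ ⟨x, y, z, rfl⟩
    have h' : Rainbow (f x b₁ c) (f x b₂ c) (f x b₃ c) := by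
      rwa [H x a₁ b₁, H x a₂ b₂, H x a₃ b₃]
    exact ⟨y, (H a₁ x y).trans ((hf.2.2 x).eq_of_rainbow_line (b := c) h' y z).symm⟩

theorem NoTight.ncard_colors_le [Fintype α] {f : α → α → α → ℕ} (hf : NoTight f) :
    (colors f).ncard ≤ Fintype.card α + 1 := by
  by_contra! hlt
  have planeZ : ∀ a₁ a₂ a₃ b₁ b₂ b₃ c, ¬ Rainbow (f a₁ b₁ c) (f a₂ b₂ c) (f a₃ b₃ c) := by
    intro a₁ a₂ a₃ b₁ b₂ b₃ c h
    have := hf.ncard_le_of_rainbow_plane h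
    omega
  have planeY : ∀ a₁ a₂ a₃ b c₁ c₂ c₃, ¬ Rainbow (f a₁ b c₁) (f a₂ b c₂) (f a₃ b c₃) := by
    intro a₁ a₂ a₃ b c₁ c₂ c₃ h
    have := hf.rotate.ncard_le_of_rainbow_plane h
    rw [colors_rotate] at this
    omega
  have planeX : ∀ a b₁ b₂ b₃ c₁ c₂ c₃, ¬ Rainbow (f a b₁ c₁) (f a b₂ c₂) (f a b₃ c₃) := by
    intro a b₁ b₂ b₃ c₁ c₂ c₃ h
    have := hf.swap₁₂.rotate.ncard_le_of_rainbow_plane h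
    rw [colors_rotate (fun b a c => f a b c), colors_swap₁₂] at this
    omega
  by_cases hc : ∃ c a b a' b', f a b c ≠ f a' b' c
  · obtain ⟨c₀, a, b, a', b', hpq⟩ := hc
    have inZ : ∀ x y, f x y c₀ = f a b c₀ ∨ f x y c₀ = f a' b' c₀ := by
      intro x y
      have := planeZ a a' x b b' y c₀
      unfold Rainbow at this
      grind
    -- Beyond the two colours of the plane `c₀`, each parallel plane carries at most one.
    have single : ∀ c, ∃ r, ∀ x y, f x y c = f a b c₀ ∨ f x y c = f a' b' c₀ ∨ f x y c = r := by
      intro c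
      by_contra! H
      obtain ⟨x, y, hxy⟩ := H (f a b c₀)
      obtain ⟨x', y', hxy'⟩ := H (f x y c)
      have out : ∀ u v, f u v c ≠ f a b c₀ ∧ f u v c ≠ f a' b' c₀ := by
        intro u v
        have h₁ := planeZ x x' u y y' v c
        unfold Rainbow at h₁
        grind
      -- The cell `(a, b', c₀)` meets each of the two chosen cells in a plane that also contains a
      -- new colour of the plane `c`, so it would need both of their colours.
      have h₁ := planeX a b b' b c₀ c₀ c
      have h₂ := planeY a a' a b' c₀ c₀ c
      have h₃ := out a b
      have h₄ := out a b'
      unfold Rainbow at h₁ h₂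
      grind
    choose h hh using single
    classical
    have : (colors f).ncard ≤ Fintype.card α + 1 := by
      refine ncard_le_of_subset_insert_range (f a b c₀)
        (fun c => if c = c₀ then f a' b' c₀ else h c) ?_
      rintro _ ⟨x, y, z, rfl⟩
      rcases hh z x y with h₁ | h₁ | h₁
      · exact Or.inl h₁
      · exact Or.inr ⟨c₀, by simp [h₁]⟩
      · by_cases hz : z = c₀
        · subst hz
          rcases inZ x y with h₂ | h₂
          · exact Or.inl h₂
          · exact Or.inr ⟨z, by simp [h₂]⟩
        · exact Or.inr ⟨z, by simp [hz, h₁]⟩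
    omega
  · push Not at hc
    obtain ⟨_, ⟨x₀, y₀, -, -⟩, -⟩ := exists_mem_notMem_of_lt_ncard (S := colors f) ∅ (by simp; omega)
    have : (colors f).ncard ≤ Fintype.card α := by
      refine ncard_le_of_subset_range (fun c => f x₀ y₀ c) ?_
      rintro _ ⟨x, y, z, rfl⟩
      exact ⟨z, hc z x₀ y₀ x y⟩
    omega

end Tight

/-! ### Upper bound for the messy path -/

section Messy

variable {α : Type*}

/-- No rainbow messy path whose first two edges differ in the first coordinate. -/
def NoMessyFirst (f : α → α → α → ℕ) : Prop :=
  ∀ a a' b b' c c', b ≠ b' → c ≠ c' → ¬ Rainbow (f a b c) (f a' b c) (f a' b' c')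

/-- A coloured cube without rainbow messy path. -/
def NoMessy (f : α → α → α → ℕ) : Prop :=
  NoMessyFirst f ∧ (NoMessyFirst fun b a c => f a b c) ∧ NoMessyFirst fun c a b => f a b c

theorem NoMessyFirst.swap₂₃ {f : α → α → α → ℕ} (hf : NoMessyFirst f) :
    NoMessyFirst fun a c b => f a b c :=
  fun a a' c c' b b' hc hb => hf a a' b b' c c' hb hc

theorem NoMessy.swap₁₂ {f : α → α → α → ℕ} (hf : NoMessy f) :
    NoMessy fun b a c => f a b c :=
  ⟨hf.2.1, hf.1, hf.2.2.swap₂₃⟩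

theorem NoMessy.swap₂₃ {f : α → α → α → ℕ} (hf : NoMessy f) :
    NoMessy fun a c b => f a b c :=
  ⟨hf.1.swap₂₃, hf.2.2, hf.2.1⟩

theorem NoMessy.rotate {f : α → α → α → ℕ} (hf : NoMessy f) :
    NoMessy fun c a b => f a b c :=
  ⟨hf.2.2, hf.1.swap₂₃, hf.2.1.swap₂₃⟩

theorem NoMessyFirst.eq_of_rainbow_line {f : α → α → α → ℕ} (hα : ∀ a b : α, ∃ c, c ≠ a ∧ c ≠ b)
    (hf : NoMessyFirst f) {a₁ a₂ a₃ b₀ c₀ : α}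
    (h : Rainbow (f a₁ b₀ c₀) (f a₂ b₀ c₀) (f a₃ b₀ c₀)) (a b c : α) : f a b c = f a b₀ c₀ := by
  have key : ∀ b₀ c₀, Rainbow (f a₁ b₀ c₀) (f a₂ b₀ c₀) (f a₃ b₀ c₀) →
      ∀ a b c, b ≠ b₀ → c ≠ c₀ → f a b c = f a b₀ c₀ := by
    intro b₀ c₀ h a b c hb hc
    have h₁ := hf a₁ a b₀ b c₀ c hb.symm hc.symm
    have h₂ := hf a₂ a b₀ b c₀ c hb.symm hc.symm
    have h₃ := hf a₃ a b₀ b c₀ c hb.symm hc.symm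
    unfold Rainbow at *
    grind
  -- `key` needs both coordinates to change. Passing through a line that avoids `b₀, b` and `c₀, c`
  -- reaches the cells that share one of them.
  obtain ⟨b', hb', hbb'⟩ := hα b₀ b
  obtain ⟨c', hc', hcc'⟩ := hα c₀ c
  have e := fun a => key b₀ c₀ h a b' c' hb' hc'
  rw [key b' c' (by rwa [e, e, e]) a b c hbb'.symm hcc'.symm, e]

/-- A cell of a third colour in a plane through a two-coloured line singles out one cell of the
line. -/
theorem NoMessy.eq_off_of_third_color {f : α → α → α → ℕ} (hα : ∀ a b : α, ∃ c, c ≠ a ∧ c ≠ b)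
    (hf : NoMessy f) {p q : ℕ} {b₀ c₀ : α} (line : ∀ a, f a b₀ c₀ = p ∨ f a b₀ c₀ = q)
    (region : ∀ a b c, b ≠ b₀ → c ≠ c₀ → f a b c = p ∨ f a b c = q) {a c : α}
    (hp : f a b₀ c ≠ p) (hq : f a b₀ c ≠ q) {x y : α} (hx : x ≠ a) (hy : y ≠ a) :
    f x b₀ c₀ = f y b₀ c₀ := by
  have hc : c ≠ c₀ := by
    rintro rfl
    exact (line a).elim hp hq
  obtain ⟨b, hb, -⟩ := hα b₀ b₀
  have h₁ := hf.2.1 b b₀ a x c c₀ hx.symm hc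
  have h₂ := hf.2.1 b b₀ a y c c₀ hy.symm hc
  have h₃ := region a b c hb hc
  have h₄ := line x
  have h₅ := line y
  unfold Rainbow at h₁ h₂
  grind

/-- A third colour can only sit in the two planes through the two-coloured line, and only over one
position `a`, the one whose removal makes the line monochromatic. Over that position there is room
for a single further colour. -/
theorem NoMessy.third_color_unique {f : α → α → α → ℕ} (hα : ∀ a b : α, ∃ c, c ≠ a ∧ c ≠ b)
    (hf : NoMessy f)
    (lineX : ∀ a₁ a₂ a₃ b c, ¬ Rainbow (f a₁ b c) (f a₂ b c) (f a₃ b c))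
    (lineY : ∀ a b₁ b₂ b₃ c, ¬ Rainbow (f a b₁ c) (f a b₂ c) (f a b₃ c))
    (lineZ : ∀ a b c₁ c₂ c₃, ¬ Rainbow (f a b c₁) (f a b c₂) (f a b c₃))
    {a₁ a₂ b₀ c₀ : α} (hpq : f a₁ b₀ c₀ ≠ f a₂ b₀ c₀) {x y z x' y' z' : α}
    (h₁ : f x y z ≠ f a₁ b₀ c₀) (h₂ : f x y z ≠ f a₂ b₀ c₀)
    (h₁' : f x' y' z' ≠ f a₁ b₀ c₀) (h₂' : f x' y' z' ≠ f a₂ b₀ c₀) :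
    f x y z = f x' y' z' := by
  generalize hp : f a₁ b₀ c₀ = p at *
  generalize hq : f a₂ b₀ c₀ = q at *
  have line : ∀ a, f a b₀ c₀ = p ∨ f a b₀ c₀ = q := by
    intro a
    have := lineX a₁ a₂ a b₀ c₀
    unfold Rainbow at this
    grind
  have region : ∀ a b c, b ≠ b₀ → c ≠ c₀ → f a b c = p ∨ f a b c = q := by
    intro a b c hb hc
    have h₁ := hf.1 a₁ a b₀ b c₀ c hb.symm hc.symm
    have h₂ := hf.1 a₂ a b₀ b c₀ c hb.symm hc.symm
    have := line a
    unfold Rainbow at h₁ h₂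
    grind
  have offY : ∀ {a c}, f a b₀ c ≠ p → f a b₀ c ≠ q → ∀ {u v}, u ≠ a → v ≠ a →
      f u b₀ c₀ = f v b₀ c₀ := fun hp hq _ _ hu hv =>
    hf.eq_off_of_third_color hα line region hp hq hu hv
  have offZ : ∀ {a b}, f a b c₀ ≠ p → f a b c₀ ≠ q → ∀ {u v}, u ≠ a → v ≠ a →
      f u b₀ c₀ = f v b₀ c₀ := fun hp hq _ _ hu hv =>
    hf.swap₂₃.eq_off_of_third_color hα line (fun a c b hc hb => region a b c hb hc) hp hq hu hv
  have same : ∀ {a a'}, (∀ {u v}, u ≠ a → v ≠ a → f u b₀ c₀ = f v b₀ c₀) →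
      (∀ {u v}, u ≠ a' → v ≠ a' → f u b₀ c₀ = f v b₀ c₀) → a = a' := by
    intro a a' h h'
    by_contra hne
    obtain ⟨w, hw, hw'⟩ := hα a a'
    have e₁ := h (Ne.symm hne) hw
    have e₂ := h' hne hw'
    have : ∀ u, f u b₀ c₀ = f w b₀ c₀ := by
      intro u
      by_cases hu : u = a
      · rw [hu, e₂]
      · exact h hu hw
    exact hpq (by rw [← hp, ← hq, this a₁, this a₂])
  -- Two different third colours, one in each plane, would complete a rainbow path from `(a', b₀,
  -- c)` through `(a, b₀, c)` to `(a, b, c₀)`.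
  have mixed : ∀ a b c, f a b₀ c ≠ p → f a b₀ c ≠ q → f a b c₀ ≠ p → f a b c₀ ≠ q →
      f a b₀ c = f a b c₀ := by
    intro a b c hr hr' hs hs'
    by_contra hrs
    obtain ⟨a', ha', -⟩ := hα a a
    have hb : b ≠ b₀ := by
      rintro rfl
      exact (line a).elim hs hs'
    have hc : c ≠ c₀ := by
      rintro rfl
      exact (line a).elim hr hr'
    have k₁ := hf.1 a' a b₀ b c c₀ hb.symm hc
    have k₂ := hf.2.2 c c₀ a' a b₀ b ha' hb.symm
    have k₃ := line a'
    have k₄ : f a' b₀ c = p ∨ f a' b₀ c = q := by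
      by_contra! k
      exact ha' (same (offY k.1 k.2) (offY hr hr'))
    unfold Rainbow at k₁ k₂
    grind
  have place : ∀ {a b c}, f a b c ≠ p → f a b c ≠ q → b = b₀ ∨ c = c₀ := by
    intro a b c hr hs
    by_contra! h
    exact (region a b c h.1 h.2).elim hr hs
  by_contra hne
  -- If both cells lie in the same plane, they share a line with a cell of the two-coloured line,
  -- and no line has three colours.
  rcases place h₁ h₂ with rfl | rfl <;> rcases place h₁' h₂' with rfl | rfl
  · obtain rfl := same (offY h₁ h₂) (offY h₁' h₂')
    have := lineZ x y' c₀ z z'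
    have := line x
    unfold Rainbow at *
    grind
  · obtain rfl := same (offY h₁ h₂) (offZ h₁' h₂')
    exact hne (mixed _ _ _ h₁ h₂ h₁' h₂')
  · obtain rfl := same (offZ h₁ h₂) (offY h₁' h₂')
    exact hne (mixed _ _ _ h₁' h₂' h₁ h₂).symm
  · obtain rfl := same (offZ h₁ h₂) (offZ h₁' h₂')
    have := lineY x b₀ y y' z'
    have := line x
    unfold Rainbow at *
    grind

theorem NoMessy.constant_first {f : α → α → α → ℕ}
    (hα : ∀ a b : α, ∃ c, c ≠ a ∧ c ≠ b) (hf : NoMessy f) (hlt : 3 < (colors f).ncard)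
    (lineX : ∀ a₁ a₂ a₃ b c, ¬ Rainbow (f a₁ b c) (f a₂ b c) (f a₃ b c))
    (lineY : ∀ a b₁ b₂ b₃ c, ¬ Rainbow (f a b₁ c) (f a b₂ c) (f a b₃ c))
    (lineZ : ∀ a b c₁ c₂ c₃, ¬ Rainbow (f a b c₁) (f a b c₂) (f a b c₃)) (a₁ a₂ b c : α) :
    f a₁ b c = f a₂ b c := by
  by_contra h
  obtain ⟨_, ⟨x, y, z, rfl⟩, hr⟩ := exists_mem_notMem_of_lt_ncard {f a₁ b c, f a₂ b c}
    (Finset.card_le_two.trans_lt (by omega : 2 < (colors f).ncard))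
  obtain ⟨_, ⟨x', y', z', rfl⟩, hs⟩ := exists_mem_notMem_of_lt_ncard
    {f a₁ b c, f a₂ b c, f x y z} (Finset.card_le_three.trans_lt hlt)
  simp only [Finset.mem_insert, Finset.mem_singleton, not_or] at hr hs
  exact hs.2.2 (hf.third_color_unique hα lineX lineY lineZ h hr.1 hr.2 hs.1 hs.2.1).symm

theorem NoMessyFirst.ncard_le_of_rainbow_line [Fintype α] {f : α → α → α → ℕ}
    (hα : ∀ a b : α, ∃ c, c ≠ a ∧ c ≠ b) (hf : NoMessyFirst f) {a₁ a₂ a₃ b c : α}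
    (h : Rainbow (f a₁ b c) (f a₂ b c) (f a₃ b c)) : (colors f).ncard ≤ Fintype.card α := by
  refine ncard_le_of_subset_range (fun a => f a b c) ?_
  rintro _ ⟨x, y, z, rfl⟩
  exact ⟨x, (hf.eq_of_rainbow_line hα h x y z).symm⟩

theorem NoMessy.ncard_colors_le [Fintype α] (hcard : 3 ≤ Fintype.card α) {f : α → α → α → ℕ}
    (hα : ∀ a b : α, ∃ c, c ≠ a ∧ c ≠ b) (hf : NoMessy f) :
    (colors f).ncard ≤ Fintype.card α := by
  by_contra! hlt
  have lineX : ∀ a₁ a₂ a₃ b c, ¬ Rainbow (f a₁ b c) (f a₂ b c) (f a₃ b c) := by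
    intro a₁ a₂ a₃ b c h
    have := hf.1.ncard_le_of_rainbow_line hα h
    omega
  have lineY : ∀ a b₁ b₂ b₃ c, ¬ Rainbow (f a b₁ c) (f a b₂ c) (f a b₃ c) := by
    intro a b₁ b₂ b₃ c h
    have := hf.2.1.ncard_le_of_rainbow_line hα h
    rw [colors_swap₁₂] at this
    omega
  have lineZ : ∀ a b c₁ c₂ c₃, ¬ Rainbow (f a b c₁) (f a b c₂) (f a b c₃) := by
    intro a b c₁ c₂ c₃ h
    have := hf.2.2.ncard_le_of_rainbow_line hα h
    rw [colors_rotate] at this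
    omega
  -- More than three colours force `f` to be constant in every direction, hence constant.
  have X := hf.constant_first hα (by omega) lineX lineY lineZ
  have Y := hf.swap₁₂.constant_first hα (by rw [colors_swap₁₂]; omega)
    (fun b₁ b₂ b₃ a c => lineY a b₁ b₂ b₃ c) (fun b a₁ a₂ a₃ c => lineX a₁ a₂ a₃ b c)
    (fun b a => lineZ a b)
  have Z := hf.rotate.constant_first hα (by rw [colors_rotate]; omega)
    (fun c₁ c₂ c₃ a b => lineZ a b c₁ c₂ c₃) (fun c a₁ a₂ a₃ b => lineX a₁ a₂ a₃ b c)
    (fun c a b₁ b₂ b₃ => lineY a b₁ b₂ b₃ c)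
  obtain ⟨_, ⟨x, y, z, rfl⟩, -⟩ := exists_mem_notMem_of_lt_ncard (S := colors f) ∅ (by simp; omega)
  obtain ⟨_, ⟨x', y', z', rfl⟩, h⟩ := exists_mem_notMem_of_lt_ncard (S := colors f) {f x y z}
    (by simp; omega)
  refine h (Finset.mem_singleton.2 ?_)
  exact (X x' x y' z').trans ((Y y' y x z').trans (Z z' z x y))

end Messy

end AntiRamsey

namespace AntiRamsey

/-! ### Upper bound for the loose path -/

section Loose

variable {α : Type*}

/-- No rainbow loose path whose three edges have distinct third coordinates. -/
def NoLooseLast (f : α → α → α → ℕ) : Prop :=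
  ∀ ⦃a a' b b' c c' c''⦄, a ≠ a' → b ≠ b' → c ≠ c' → c ≠ c'' → c' ≠ c'' →
    ¬ Rainbow (f a b c) (f a b' c') (f a' b' c'')

/-- A coloured cube without rainbow loose path. -/
def NoLoose (f : α → α → α → ℕ) : Prop :=
  NoLooseLast f ∧ (NoLooseLast fun a c b => f a b c) ∧ NoLooseLast fun b c a => f a b c

theorem Rainbow.rev {p q r : ℕ} (h : Rainbow p q r) : Rainbow r q p :=
  ⟨h.2.2.symm, h.2.1.symm, h.1.symm⟩

theorem NoLooseLast.swap₁₂ {f : α → α → α → ℕ} (hf : NoLooseLast f) :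
    NoLooseLast fun b a c => f a b c :=
  fun _ _ _ _ _ _ _ hb ha h h' h'' H => hf ha.symm hb.symm h''.symm h'.symm h.symm H.rev

theorem NoLoose.swap₁₂ {f : α → α → α → ℕ} (hf : NoLoose f) : NoLoose fun b a c => f a b c :=
  ⟨hf.1.swap₁₂, hf.2.2, hf.2.1⟩

theorem NoLoose.swap₂₃ {f : α → α → α → ℕ} (hf : NoLoose f) : NoLoose fun a c b => f a b c :=
  ⟨hf.2.1, hf.1, hf.2.2.swap₁₂⟩

/-- Two cells are far apart if they differ in at least two coordinates. -/
def Far (a b c a' b' c' : α) : Prop :=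
  (a ≠ a' ∨ b ≠ b') ∧ (a ≠ a' ∨ c ≠ c') ∧ (b ≠ b' ∨ c ≠ c')

variable {f : α → α → α → ℕ}

/-- Loose paths force the second colour on `(a', b₁, c₃)` and the third on `(a'', b₂, c₁)`; joined
through `(a, b₁, c₁)`, these form a rainbow loose path. -/
theorem NoLoose.not_rainbow_plane (hα : ∀ a b : α, ∃ c, c ≠ a ∧ c ≠ b) (hf : NoLoose f)
    {a b₁ b₂ b₃ c₁ c₂ c₃ : α} (hb₁₂ : b₁ ≠ b₂) (hb₁₃ : b₁ ≠ b₃) (hb₂₃ : b₂ ≠ b₃)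
    (hc₁₂ : c₁ ≠ c₂) (hc₁₃ : c₁ ≠ c₃) (hc₂₃ : c₂ ≠ c₃) :
    ¬ Rainbow (f a b₁ c₁) (f a b₂ c₂) (f a b₃ c₃) := by
  intro h
  obtain ⟨a', ha', -⟩ := hα a a
  obtain ⟨a'', ha'', haa⟩ := hα a a'
  have k₁ := hf.1 ha'.symm hb₁₂.symm hc₁₂.symm hc₂₃ hc₁₃
  have k₂ := hf.2.1 ha'.symm hc₂₃ hb₂₃ hb₁₂.symm hb₁₃.symm
  have k₃ := hf.2.1 ha''.symm hc₁₃.symm hb₁₃.symm hb₂₃.symm hb₁₂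
  have k₄ := hf.1 ha''.symm hb₂₃.symm hc₂₃.symm hc₁₃.symm hc₁₂.symm
  have k₅ := hf.2.2 hb₁₂ hc₁₃.symm ha' haa.symm ha''.symm
  unfold Rainbow at *
  grind

/-- The second colour is forced on `(a₂, b₂, c₃)` and the third on `(a₃, b₂, c₂)`, which gives a
rainbow triple in the plane `b₂`. -/
theorem NoLoose.not_rainbow_triangle (hα : ∀ a b : α, ∃ c, c ≠ a ∧ c ≠ b) (hf : NoLoose f)
    {a₁ a₂ b₁ b₂ c₁ c₂ : α} (ha : a₁ ≠ a₂) (hb : b₁ ≠ b₂) (hc : c₁ ≠ c₂) :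
    ¬ Rainbow (f a₁ b₂ c₁) (f a₁ b₁ c₂) (f a₂ b₁ c₁) := by
  intro h
  obtain ⟨a₃, ha₁, ha₂⟩ := hα a₁ a₂
  obtain ⟨c₃, hc₁, hc₂⟩ := hα c₁ c₂
  have k₁ := hf.1 ha hb hc.symm hc₂.symm hc₁.symm
  have k₂ := hf.1.swap₁₂ hb ha hc.symm hc₂.symm hc₁.symm
  have k₃ := hf.2.2.swap₁₂ hc hb ha.symm ha₂.symm ha₁.symm
  have k₄ := hf.2.2 hb hc ha.symm ha₂.symm ha₁.symm
  have k₅ := hf.swap₁₂.not_rainbow_plane (a := b₂) hα ha ha₁.symm ha₂.symm hc₁.symm hc hc₂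
  unfold Rainbow at *
  grind

theorem NoLoose.not_rainbow_pair_single (hα : ∀ a b : α, ∃ c, c ≠ a ∧ c ≠ b) (hf : NoLoose f)
    {a₁ a₂ b₁ b₂ b₃ c₁ c₂ c₃ : α} (ha : a₁ ≠ a₂) (hb₁₂ : b₁ ≠ b₂) (hb₁₃ : b₁ ≠ b₃)
    (hb₂₃ : b₂ ≠ b₃) (hc₁₂ : c₁ ≠ c₂) (hc₁₃ : c₁ ≠ c₃) (hc₂₃ : c₂ ≠ c₃) :
    ¬ Rainbow (f a₁ b₁ c₁) (f a₁ b₂ c₂) (f a₂ b₃ c₃) := by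
  intro h
  obtain ⟨a₃, ha₁, ha₂⟩ := hα a₁ a₂
  have k₁ := hf.2.1 ha₁.symm hc₁₂.symm hb₁₂.symm hb₂₃ hb₁₃
  have k₂ := hf.2.2.swap₁₂ hc₁₃ hb₁₃ ha₁.symm ha ha₂
  have k₃ := hf.1 ha₁.symm hb₁₂ hc₁₂ hc₁₃ hc₂₃
  have k₄ := hf.2.2 hb₂₃ hc₂₃ ha₁.symm ha ha₂
  have k₅ := hf.2.1 ha hc₂₃ hb₁₂.symm hb₂₃ hb₁₃
  have k₆ := hf.2.1 ha₁ hc₁₃ hb₂₃.symm hb₁₃.symm hb₁₂.symm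
  have k₇ := hf.1 ha hb₁₃ hc₁₂ hc₁₃ hc₂₃
  have k₈ := hf.1.swap₁₂ hb₁₃.symm ha₁ hc₁₂ hc₁₃ hc₂₃
  have k₉ := hf.not_rainbow_triangle hα ha hb₁₃.symm hc₂₃.symm
  unfold Rainbow at *
  grind

/-- The cell `(a₁, b₂, c₃)` is the middle of a loose path between any two of the three cells, so its
colour would lie in each of the three pairs of colours. -/
theorem NoLoose.not_rainbow_matching (hf : NoLoose f) {a₁ a₂ a₃ b₁ b₂ b₃ c₁ c₂ c₃ : α}
    (ha₁₂ : a₁ ≠ a₂) (ha₁₃ : a₁ ≠ a₃) (ha₂₃ : a₂ ≠ a₃) (hb₁₂ : b₁ ≠ b₂) (hb₁₃ : b₁ ≠ b₃)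
    (hb₂₃ : b₂ ≠ b₃) (hc₁₂ : c₁ ≠ c₂) (hc₁₃ : c₁ ≠ c₃) (hc₂₃ : c₂ ≠ c₃) :
    ¬ Rainbow (f a₁ b₁ c₁) (f a₂ b₂ c₂) (f a₃ b₃ c₃) := by
  intro h
  have k₁ := hf.1 ha₁₂ hb₁₂ hc₁₃ hc₁₂ hc₂₃.symm
  have k₂ := hf.2.1 ha₁₃ hc₁₃ hb₁₂ hb₁₃ hb₂₃
  have k₃ := hf.2.2 hb₂₃ hc₂₃ ha₁₂.symm ha₂₃ ha₁₃
  unfold Rainbow at *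
  grind

/-- The cases are the coincidences of the third cell with the other two: same plane, triangle, an
actual loose path, or no shared coordinate. -/
theorem NoLoose.not_rainbow_of_share (hα : ∀ a b : α, ∃ c, c ≠ a ∧ c ≠ b) (hf : NoLoose f)
    {a a₃ b₁ b₂ b₃ c₁ c₂ c₃ : α} (h₁₂ : Far a b₁ c₁ a b₂ c₂) (h₁₃ : Far a b₁ c₁ a₃ b₃ c₃)
    (h₂₃ : Far a b₂ c₂ a₃ b₃ c₃) : ¬ Rainbow (f a b₁ c₁) (f a b₂ c₂) (f a₃ b₃ c₃) := by
  have hb : b₁ ≠ b₂ := by unfold Far at h₁₂; grind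
  have hc : c₁ ≠ c₂ := by unfold Far at h₁₂; grind
  by_cases ha : a = a₃
  · subst ha
    exact hf.not_rainbow_plane hα hb (by unfold Far at h₁₃; grind) (by unfold Far at h₂₃; grind)
      hc (by unfold Far at h₁₃; grind) (by unfold Far at h₂₃; grind)
  intro h
  by_cases e₁ : b₁ = b₃
  · subst e₁
    have h₁ : c₁ ≠ c₃ := by unfold Far at h₁₃; grind
    by_cases e₂ : c₂ = c₃
    · subst e₂
      have := hf.not_rainbow_triangle hα ha hb hc.symm
      unfold Rainbow at *
      grind
    · have := hf.1 ha hb.symm hc.symm e₂ h₁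
      unfold Rainbow at *
      grind
  by_cases e₂ : b₂ = b₃
  · subst e₂
    have h₁ : c₂ ≠ c₃ := by unfold Far at h₂₃; grind
    by_cases e₃ : c₁ = c₃
    · subst e₃
      have := hf.not_rainbow_triangle hα ha hb.symm hc
      unfold Rainbow at *
      grind
    · exact hf.1 ha hb hc e₃ h₁ h
  by_cases e₃ : c₁ = c₃
  · subst e₃
    have := hf.2.1 ha hc.symm hb.symm e₂ e₁
    unfold Rainbow at *
    grind
  by_cases e₄ : c₂ = c₃
  · subst e₄
    exact hf.2.1 ha hc hb e₁ e₂ h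
  exact hf.not_rainbow_pair_single hα ha hb e₁ e₂ hc e₃ e₄ h

theorem Far.symm {a b c a' b' c' : α} (h : Far a b c a' b' c') : Far a' b' c' a b c := by
  unfold Far at *
  grind

theorem NoLoose.not_rainbow_of_share_any (hα : ∀ a b : α, ∃ c, c ≠ a ∧ c ≠ b) (hf : NoLoose f)
    {a₁ a₂ a₃ b₁ b₂ b₃ c₁ c₂ c₃ : α} (h₁₂ : Far a₁ b₁ c₁ a₂ b₂ c₂) (h₁₃ : Far a₁ b₁ c₁ a₃ b₃ c₃)
    (h₂₃ : Far a₂ b₂ c₂ a₃ b₃ c₃) (h : a₁ = a₂ ∨ b₁ = b₂ ∨ c₁ = c₂) :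
    ¬ Rainbow (f a₁ b₁ c₁) (f a₂ b₂ c₂) (f a₃ b₃ c₃) := by
  rcases h with rfl | rfl | rfl
  · exact hf.not_rainbow_of_share hα h₁₂ h₁₃ h₂₃
  · refine hf.swap₁₂.not_rainbow_of_share hα ?_ ?_ ?_ <;> unfold Far at * <;> grind
  · refine hf.swap₂₃.swap₁₂.not_rainbow_of_share hα ?_ ?_ ?_ <;> unfold Far at * <;> grind

theorem NoLoose.not_rainbow_far (hα : ∀ a b : α, ∃ c, c ≠ a ∧ c ≠ b) (hf : NoLoose f)
    {a₁ a₂ a₃ b₁ b₂ b₃ c₁ c₂ c₃ : α} (h₁₂ : Far a₁ b₁ c₁ a₂ b₂ c₂) (h₁₃ : Far a₁ b₁ c₁ a₃ b₃ c₃)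
    (h₂₃ : Far a₂ b₂ c₂ a₃ b₃ c₃) : ¬ Rainbow (f a₁ b₁ c₁) (f a₂ b₂ c₂) (f a₃ b₃ c₃) := by
  intro h
  by_cases e₁ : a₁ = a₂ ∨ b₁ = b₂ ∨ c₁ = c₂
  · exact hf.not_rainbow_of_share_any hα h₁₂ h₁₃ h₂₃ e₁ h
  by_cases e₂ : a₁ = a₃ ∨ b₁ = b₃ ∨ c₁ = c₃
  · exact hf.not_rainbow_of_share_any hα h₁₃ h₁₂ h₂₃.symm e₂ ⟨h.2.1, h.1, h.2.2.symm⟩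
  by_cases e₃ : a₂ = a₃ ∨ b₂ = b₃ ∨ c₂ = c₃
  · exact hf.not_rainbow_of_share_any hα h₂₃ h₁₂.symm h₁₃.symm e₃ ⟨h.2.2, h.1.symm, h.2.1.symm⟩
  push Not at e₁ e₂ e₃
  exact hf.not_rainbow_matching e₁.1 e₂.1 e₃.1 e₁.2.1 e₂.2.1 e₃.2.1 e₁.2.2 e₂.2.2 e₃.2.2 h

/-- Two pairs of far cells, close to each other cell by cell, have a common far cell. -/
theorem exists_far_of_close (hα : ∀ a b : α, ∃ c, c ≠ a ∧ c ≠ b)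
    {a₁ a₂ b₁ b₂ c₁ c₂ x₁ x₂ y₁ y₂ z₁ z₂ : α} (h₁ : ¬ Far a₁ b₁ c₁ x₁ y₁ z₁)
    (h₂ : ¬ Far a₂ b₂ c₂ x₂ y₂ z₂) :
    ∃ a b c, Far a b c a₁ b₁ c₁ ∧ Far a b c a₂ b₂ c₂ ∧ Far a b c x₁ y₁ z₁ ∧
      Far a b c x₂ y₂ z₂ := by
  have h₁' : (b₁ = y₁ ∧ c₁ = z₁) ∨ (a₁ = x₁ ∧ c₁ = z₁) ∨ (a₁ = x₁ ∧ b₁ = y₁) := by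
    unfold Far at h₁; grind
  have h₂' : (b₂ = y₂ ∧ c₂ = z₂) ∨ (a₂ = x₂ ∧ c₂ = z₂) ∨ (a₂ = x₂ ∧ b₂ = y₂) := by
    unfold Far at h₂; grind
  clear h₁ h₂
  obtain ⟨a, ha₁, ha₂⟩ := hα a₁ a₂
  obtain ⟨b, hb₁, hb₂⟩ := hα b₁ b₂
  obtain ⟨c, hc₁, hc₂⟩ := hα c₁ c₂
  obtain ⟨a', ha₁', ha₂'⟩ := hα a₁ x₁
  obtain ⟨b', hb₁', hb₂'⟩ := hα b₁ y₁
  obtain ⟨c', hc₁', hc₂'⟩ := hα c₁ z₁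
  obtain ⟨a'', ha₁'', ha₂''⟩ := hα a₂ x₂
  obtain ⟨b'', hb₁'', hb₂''⟩ := hα b₂ y₂
  obtain ⟨c'', hc₁'', hc₂''⟩ := hα c₂ z₂
  -- Close cells differ in at most one coordinate. According to the directions in which the two
  -- pairs vary, the new cell can avoid each pair in two coordinates while no coordinate avoids more
  -- than two values.
  rcases h₁' with ⟨rfl, rfl⟩ | ⟨rfl, rfl⟩ | ⟨rfl, rfl⟩ <;>
    rcases h₂' with ⟨rfl, rfl⟩ | ⟨rfl, rfl⟩ | ⟨rfl, rfl⟩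
  · exact ⟨a, b, c, by unfold Far; tauto⟩
  · exact ⟨a', b'', c, by unfold Far; tauto⟩
  · exact ⟨a', b, c'', by unfold Far; tauto⟩
  · exact ⟨a'', b', c, by unfold Far; tauto⟩
  · exact ⟨a, b, c, by unfold Far; tauto⟩
  · exact ⟨a, b', c'', by unfold Far; tauto⟩
  · exact ⟨a'', b, c', by unfold Far; tauto⟩
  · exact ⟨a, b'', c', by unfold Far; tauto⟩
  · exact ⟨a, b, c, by unfold Far; tauto⟩

/-- A pair of distinct colours occurs on two far cells. -/
def FarPair (f : α → α → α → ℕ) (p q : ℕ) : Prop :=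
  p ≠ q ∧ ∃ a b c a' b' c', Far a b c a' b' c' ∧ f a b c = p ∧ f a' b' c' = q

/-- The colour of a cell far from all four must belong to both pairs. -/
theorem NoLoose.inter_of_close (hα : ∀ a b : α, ∃ c, c ≠ a ∧ c ≠ b) (hf : NoLoose f)
    {a₁ a₂ b₁ b₂ c₁ c₂ x₁ x₂ y₁ y₂ z₁ z₂ : α} (h : Far a₁ b₁ c₁ a₂ b₂ c₂)
    (h' : Far x₁ y₁ z₁ x₂ y₂ z₂) (hc₁ : ¬ Far a₁ b₁ c₁ x₁ y₁ z₁) (hc₂ : ¬ Far a₂ b₂ c₂ x₂ y₂ z₂)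
    (hne : f a₁ b₁ c₁ ≠ f a₂ b₂ c₂) (hne' : f x₁ y₁ z₁ ≠ f x₂ y₂ z₂) :
    f a₁ b₁ c₁ = f x₁ y₁ z₁ ∨ f a₁ b₁ c₁ = f x₂ y₂ z₂ ∨ f a₂ b₂ c₂ = f x₁ y₁ z₁ ∨
      f a₂ b₂ c₂ = f x₂ y₂ z₂ := by
  obtain ⟨a, b, c, h₁, h₂, h₃, h₄⟩ := exists_far_of_close hα hc₁ hc₂
  have k₁ := hf.not_rainbow_far hα h₁ h₂ h
  have k₂ := hf.not_rainbow_far hα h₃ h₄ h'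
  unfold Rainbow at *
  grind

/-- If the pairs were disjoint, each of the four cells would be close to a cell of the other pair.
Closeness then contains a perfect matching between the pairs, which is the situation of
`NoLoose.inter_of_close`. -/
theorem NoLoose.farPair_inter (hα : ∀ a b : α, ∃ c, c ≠ a ∧ c ≠ b) (hf : NoLoose f)
    {p q r s : ℕ} (h : FarPair f p q) (h' : FarPair f r s) : p = r ∨ p = s ∨ q = r ∨ q = s := by
  obtain ⟨hpq, a₁, b₁, c₁, a₂, b₂, c₂, hfar, rfl, rfl⟩ := h
  obtain ⟨hrs, x₁, y₁, z₁, x₂, y₂, z₂, hfar', rfl, rfl⟩ := h'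
  by_contra H
  push Not at H
  have k₁ : ¬ (Far a₁ b₁ c₁ x₁ y₁ z₁ ∧ Far a₂ b₂ c₂ x₁ y₁ z₁) := fun k =>
    hf.not_rainbow_far hα hfar k.1 k.2 ⟨hpq, H.1, H.2.2.1⟩
  have k₂ : ¬ (Far a₁ b₁ c₁ x₂ y₂ z₂ ∧ Far a₂ b₂ c₂ x₂ y₂ z₂) := fun k =>
    hf.not_rainbow_far hα hfar k.1 k.2 ⟨hpq, H.2.1, H.2.2.2⟩
  have k₃ : ¬ (Far a₁ b₁ c₁ x₁ y₁ z₁ ∧ Far a₁ b₁ c₁ x₂ y₂ z₂) := fun k =>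
    hf.not_rainbow_far hα k.1 k.2 hfar' ⟨H.1, H.2.1, hrs⟩
  have k₄ : ¬ (Far a₂ b₂ c₂ x₁ y₁ z₁ ∧ Far a₂ b₂ c₂ x₂ y₂ z₂) := fun k =>
    hf.not_rainbow_far hα k.1 k.2 hfar' ⟨H.2.2.1, H.2.2.2, hrs⟩
  have m₁ := hf.inter_of_close hα hfar hfar'
  have m₂ := hf.inter_of_close hα hfar hfar'.symm
  tauto

/-- A cell avoiding all coordinates of two differently coloured cells is far from both, and it
differs in colour from at least one. -/
theorem exists_farPair (hα : ∀ a b : α, ∃ c, c ≠ a ∧ c ≠ b) {p q : ℕ} (hp : p ∈ colors f)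
    (hq : q ∈ colors f) (hpq : p ≠ q) : ∃ r ∈ colors f, FarPair f p r := by
  obtain ⟨a, b, c, rfl⟩ := hp
  obtain ⟨a', b', c', rfl⟩ := hq
  obtain ⟨x, hx, hx'⟩ := hα a a'
  obtain ⟨y, hy, hy'⟩ := hα b b'
  obtain ⟨z, hz, hz'⟩ := hα c c'
  by_cases h : f a b c = f x y z
  · exact ⟨_, ⟨a', b', c', rfl⟩, hpq, x, y, z, a', b', c', by unfold Far; tauto, h.symm, rfl⟩
  · exact ⟨_, ⟨x, y, z, rfl⟩, h, a, b, c, x, y, z, by unfold Far; grind, rfl, rfl⟩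

/-- One colour takes part in every pair of distinct colours on far cells. -/
theorem NoLoose.exists_dominant (hα : ∀ a b : α, ∃ c, c ≠ a ∧ c ≠ b) (hf : NoLoose f)
    (hlt : 3 < (colors f).ncard) :
    ∃ p, ∀ a b c a' b' c', Far a b c a' b' c' → f a b c ≠ p → f a' b' c' ≠ p →
      f a b c = f a' b' c' := by
  obtain ⟨p, hp, -⟩ := exists_mem_notMem_of_lt_ncard (S := colors f) ∅ (by simp; omega)
  obtain ⟨p', hp', hpp'⟩ := exists_mem_notMem_of_lt_ncard (S := colors f) {p} (by simp; omega)
  obtain ⟨q, hq, hpq⟩ := exists_farPair hα hp hp' (by simpa [eq_comm] using hpp')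
  obtain ⟨r, hr, hr'⟩ := exists_mem_notMem_of_lt_ncard {p, q}
    (Finset.card_le_two.trans_lt (by omega : 2 < (colors f).ncard))
  obtain ⟨s, hs, hs'⟩ := exists_mem_notMem_of_lt_ncard {p, q, r}
    (Finset.card_le_three.trans_lt hlt)
  simp only [Finset.mem_insert, Finset.mem_singleton, not_or] at hr' hs'
  obtain ⟨u, hu, hru⟩ := exists_farPair hα hr hp hr'.1
  obtain ⟨v, hv, hsv⟩ := exists_farPair hα hs hp hs'.1
  have k₁ := hf.farPair_inter hα hpq hru
  have k₂ := hf.farPair_inter hα hpq hsv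
  have k₃ := hf.farPair_inter hα hru hsv
  -- Intersection forces `u = v ∈ {p, q}`. A pair without `u` would have to contain `r`, `s` and the
  -- other one of `p, q`.
  refine ⟨u, fun a b c a' b' c' hfar h₁ h₂ => ?_⟩
  by_contra hne
  have hx : FarPair f (f a b c) (f a' b' c') := ⟨hne, a, b, c, a', b', c', hfar, rfl, rfl⟩
  have m₁ := hf.farPair_inter hα hx hpq
  have m₂ := hf.farPair_inter hα hx hru
  have m₃ := hf.farPair_inter hα hx hsv
  grind

theorem NoLoose.ncard_colors_le [Fintype α] (hcard : 3 ≤ Fintype.card α)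
    (hα : ∀ a b : α, ∃ c, c ≠ a ∧ c ≠ b) (hf : NoLoose f) :
    (colors f).ncard ≤ Fintype.card α + 1 := by
  by_contra! hlt
  obtain ⟨p, hp⟩ := hf.exists_dominant hα (by omega)
  obtain ⟨_, ⟨a₁, b₁, c₁, rfl⟩, h₁⟩ := exists_mem_notMem_of_lt_ncard (S := colors f) {p}
    (by simp; omega)
  obtain ⟨_, ⟨a₂, b₂, c₂, rfl⟩, h₂⟩ := exists_mem_notMem_of_lt_ncard {p, f a₁ b₁ c₁}
    (Finset.card_le_two.trans_lt (by omega : 2 < (colors f).ncard))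
  obtain ⟨_, ⟨a₃, b₃, c₃, rfl⟩, h₃⟩ := exists_mem_notMem_of_lt_ncard
    {p, f a₁ b₁ c₁, f a₂ b₂ c₂} (Finset.card_le_three.trans_lt (by omega : 3 < (colors f).ncard))
  simp only [Finset.mem_insert, Finset.mem_singleton, not_or] at h₁ h₂ h₃
  have close : ∀ {a b c a' b' c'}, f a b c ≠ p → f a' b' c' ≠ p → f a b c ≠ f a' b' c' →
      (b = b' ∧ c = c') ∨ (a = a' ∧ c = c') ∨ (a = a' ∧ b = b') := by
    intro a b c a' b' c' h h' hne
    have := mt (hp a b c a' b' c')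
    unfold Far at this
    grind
  have k₁₂ := close h₁ h₂.1 (Ne.symm h₂.2)
  have k₁₃ := close h₁ h₃.1 (Ne.symm h₃.2.1)
  have k₂₃ := close h₂.1 h₃.1 (Ne.symm h₃.2.2)
  -- Three pairwise close cells of distinct colours lie on a line. Any other cell not coloured `p`
  -- is close to at least two of them, hence on the same line.
  have key : (∀ a b c, f a b c ≠ p → b = b₁ ∧ c = c₁) ∨ (∀ a b c, f a b c ≠ p → a = a₁ ∧ c = c₁) ∨
      (∀ a b c, f a b c ≠ p → a = a₁ ∧ b = b₁) := by
    have m₁ := fun a b c (h : f a b c ≠ p) => close h h₁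
    have m₂ := fun a b c (h : f a b c ≠ p) => close h h₂.1
    have m₃ := fun a b c (h : f a b c ≠ p) => close h h₃.1
    rcases k₁₂ with k | k | k
    · refine Or.inl fun a b c h => ?_
      have m₁ := m₁ a b c h
      have m₂ := m₂ a b c h
      have m₃ := m₃ a b c h
      grind
    · refine Or.inr (Or.inl fun a b c h => ?_)
      have m₁ := m₁ a b c h
      have m₂ := m₂ a b c h
      have m₃ := m₃ a b c h
      grind
    · refine Or.inr (Or.inr fun a b c h => ?_)
      have m₁ := m₁ a b c h
      have m₂ := m₂ a b c h
      have m₃ := m₃ a b c h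
      grind
  have : (colors f).ncard ≤ Fintype.card α + 1 := by
    rcases key with key | key | key
    · refine ncard_le_of_subset_insert_range p (fun a => f a b₁ c₁) ?_
      rintro _ ⟨x, y, z, rfl⟩
      by_cases h : f x y z = p
      · exact Or.inl h
      · obtain ⟨rfl, rfl⟩ := key x y z h
        exact Or.inr ⟨x, rfl⟩
    · refine ncard_le_of_subset_insert_range p (fun b => f a₁ b c₁) ?_
      rintro _ ⟨x, y, z, rfl⟩
      by_cases h : f x y z = p
      · exact Or.inl h
      · obtain ⟨rfl, rfl⟩ := key x y z h
        exact Or.inr ⟨y, rfl⟩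
    · refine ncard_le_of_subset_insert_range p (fun c => f a₁ b₁ c) ?_
      rintro _ ⟨x, y, z, rfl⟩
      by_cases h : f x y z = p
      · exact Or.inl h
      · obtain ⟨rfl, rfl⟩ := key x y z h
        exact Or.inr ⟨z, rfl⟩
  omega

end Loose

end AntiRamsey

namespace AntiRamsey

/-! ### From hypergraph copies to cells of the cube -/

section Bridge

variable {n : ℕ}

/-- The edge with vertices `a`, `b`, `c` in the parts `i`, `j`, `k`. -/
def cell (i j k : Fin 3) (a b c : Fin n) : Set (Fin 3 × Fin n) := {(i, a), (j, b), (k, c)}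

theorem cell_swap₁₂ (i j k : Fin 3) (a b c : Fin n) : cell j i k b a c = cell i j k a b c :=
  Set.insert_comm _ _ _

theorem cell_swap₂₃ (i j k : Fin 3) (a b c : Fin n) : cell i k j a c b = cell i j k a b c := by
  unfold cell
  rw [Set.pair_comm]

theorem cell_mem {i j k : Fin 3} (hij : i ≠ j) (hik : i ≠ k) (hjk : j ≠ k) (a b c : Fin n) :
    cell i j k a b c ∈ (completePartite 3 n).edgeSet := by
  refine ⟨Set.ncard_eq_three.2 ⟨_, _, _, ?_, ?_, ?_, rfl⟩, fun l => ?_⟩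
  · simp [hij]
  · simp [hik]
  · simp [hjk]
  · have hl : l = i ∨ l = j ∨ l = k := by omega
    rw [Set.ncard_eq_one]
    rcases hl with rfl | rfl | rfl
    · refine ⟨(l, a), ?_⟩
      ext v
      simp only [cell, Set.mem_inter_iff, Set.mem_insert_iff, Set.mem_singleton_iff,
        Set.mem_ofPred_eq]
      grind
    · refine ⟨(l, b), ?_⟩
      ext v
      simp only [cell, Set.mem_inter_iff, Set.mem_insert_iff, Set.mem_singleton_iff,
        Set.mem_ofPred_eq]
      grind
    · refine ⟨(l, c), ?_⟩
      ext v
      simp only [cell, Set.mem_inter_iff, Set.mem_insert_iff, Set.mem_singleton_iff,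
        Set.mem_ofPred_eq]
      grind

theorem exists_eq_cell {e : Set (Fin 3 × Fin n)} (he : e ∈ (completePartite 3 n).edgeSet) :
    ∃ a b c, e = cell 0 1 2 a b c := by
  have h : ∀ i : Fin 3, ∃ a : Fin n, ∀ v, v ∈ e ∧ v.1 = i ↔ v = (i, a) := by
    intro i
    obtain ⟨w, hw⟩ := Set.ncard_eq_one.1 (he.2 i)
    have hw' : ∀ v, v ∈ e ∧ v.1 = i ↔ v = w := fun v => by
      simpa using Set.ext_iff.1 hw v
    have := ((hw' w).2 rfl).2
    exact ⟨w.2, fun v => by rw [hw', ← this]⟩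
  choose x hx using h
  refine ⟨x 0, x 1, x 2, ?_⟩
  ext v
  simp only [cell, Set.mem_insert_iff, Set.mem_singleton_iff, ← hx]
  have : v.1 = 0 ∨ v.1 = 1 ∨ v.1 = 2 := by omega
  tauto

theorem eq_of_mem_edge {e : Set (Fin 3 × Fin n)} (he : e ∈ (completePartite 3 n).edgeSet)
    {v w : Fin 3 × Fin n} (hv : v ∈ e) (hw : w ∈ e) (h : v.1 = w.1) : v = w := by
  obtain ⟨u, hu⟩ := Set.ncard_eq_one.1 (he.2 v.1)
  have hv' : v ∈ e ∩ {x | x.1 = v.1} := ⟨hv, rfl⟩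
  have hw' : w ∈ e ∩ {x | x.1 = v.1} := ⟨hw, h.symm⟩
  rw [hu] at hv' hw'
  exact (Set.mem_singleton_iff.1 hv').trans (Set.mem_singleton_iff.1 hw').symm

open Classical in
/-- An edge-colouring, extended by zero to all vertex sets. -/
noncomputable def extend (c : (completePartite 3 n).edgeSet → ℕ) (e : Set (Fin 3 × Fin n)) : ℕ :=
  if h : e ∈ (completePartite 3 n).edgeSet then c ⟨e, h⟩ else 0

theorem extend_of_mem (c : (completePartite 3 n).edgeSet → ℕ) {e : Set (Fin 3 × Fin n)}
    (h : e ∈ (completePartite 3 n).edgeSet) : extend c e = c ⟨e, h⟩ := dif_pos h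

theorem colors_extend (c : (completePartite 3 n).edgeSet → ℕ) :
    colors (fun x y z => extend c (cell 0 1 2 x y z)) = Set.range c := by
  ext p
  constructor
  · rintro ⟨x, y, z, rfl⟩
    exact ⟨⟨_, cell_mem (by decide) (by decide) (by decide) x y z⟩, (extend_of_mem c _).symm⟩
  · rintro ⟨⟨e, he⟩, rfl⟩
    obtain ⟨x, y, z, rfl⟩ := exists_eq_cell he
    exact ⟨x, y, z, extend_of_mem c he⟩

theorem hasRainbowCopy_of_rainbow {β : Type*} {G : Hypergraph β} {A B D : Set β}
    (hG : G.edgeSet = {A, B, D}) (c : (completePartite 3 n).edgeSet → ℕ) (φ : β → Fin 3 × Fin n)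
    (hφ : Function.Injective φ) (hA : φ '' A ∈ (completePartite 3 n).edgeSet)
    (hB : φ '' B ∈ (completePartite 3 n).edgeSet) (hD : φ '' D ∈ (completePartite 3 n).edgeSet)
    (h : Rainbow (extend c (φ '' A)) (extend c (φ '' B)) (extend c (φ '' D))) :
    HasRainbowCopy (completePartite 3 n) c G := by
  have hmem : ∀ e ∈ G.edgeSet, e = A ∨ e = B ∨ e = D := fun e he => by simpa [hG] using he
  refine ⟨φ, fun _ _ => Set.mem_univ _, hφ.injOn, fun e he => ?_, ?_⟩
  · rcases hmem e he with rfl | rfl | rfl <;> assumption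
  · rw [extend_of_mem c hA, extend_of_mem c hB, extend_of_mem c hD] at h
    rintro ⟨e, he⟩ ⟨e', he'⟩ heq
    have h₁ := h.1
    have h₂ := h.2.1
    have h₃ := h.2.2
    rcases hmem e he with rfl | rfl | rfl <;> rcases hmem e' he' with rfl | rfl | rfl <;>
      first
      | rfl
      | exact absurd heq (by assumption)
      | exact absurd heq.symm (by assumption)

theorem HasRainbowCopy.exists_rainbow {β : Type*} {G : Hypergraph β} {A B D : Set β}
    (hG : G.edgeSet = {A, B, D}) (hV : G.vertexSet = Set.univ) (hAB : A ≠ B) (hAD : A ≠ D)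
    (hBD : B ≠ D) {c : (completePartite 3 n).edgeSet → ℕ}
    (h : HasRainbowCopy (completePartite 3 n) c G) :
    ∃ φ : β → Fin 3 × Fin n, Function.Injective φ ∧
      ∃ (hA : φ '' A ∈ (completePartite 3 n).edgeSet)
        (hB : φ '' B ∈ (completePartite 3 n).edgeSet)
        (hD : φ '' D ∈ (completePartite 3 n).edgeSet),
        Rainbow (c ⟨φ '' A, hA⟩) (c ⟨φ '' B, hB⟩) (c ⟨φ '' D, hD⟩) := by
  obtain ⟨φ, -, hinj, hφ, hc⟩ := h
  rw [hV] at hinj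
  have hA : A ∈ G.edgeSet := by simp [hG]
  have hB : B ∈ G.edgeSet := by simp [hG]
  have hD : D ∈ G.edgeSet := by simp [hG]
  refine ⟨φ, Set.injOn_univ.1 hinj, hφ A hA, hφ B hB, hφ D hD, ?_, ?_, ?_⟩
  · exact fun h => hAB (congrArg Subtype.val (@hc ⟨A, hA⟩ ⟨B, hB⟩ h))
  · exact fun h => hAD (congrArg Subtype.val (@hc ⟨A, hA⟩ ⟨D, hD⟩ h))
  · exact fun h => hBD (congrArg Subtype.val (@hc ⟨B, hB⟩ ⟨D, hD⟩ h))

theorem image_triple {β γ : Type*} (φ : β → γ) (x y z : β) :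
    φ '' {x, y, z} = {φ x, φ y, φ z} := by
  simp [Set.image_insert_eq]

variable {c : (completePartite 3 n).edgeSet → ℕ}

theorem not_rainbow_tight (h : ¬ HasRainbowCopy (completePartite 3 n) c tightPath)
    {i j k : Fin 3} (hij : i ≠ j) (hik : i ≠ k) (hjk : j ≠ k) (a a' b b' z : Fin n) :
    ¬ Rainbow (extend c (cell i j k a b z)) (extend c (cell i j k a' b z))
      (extend c (cell i j k a' b' z)) := by
  intro hr
  have ha : a ≠ a' := by rintro rfl; exact hr.1 rfl
  have hb : b ≠ b' := by rintro rfl; exact hr.2.2 rfl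
  -- In a tight path, the vertices 0 and 3 share a part, as do 1 and 4.
  let φ : Fin 5 → Fin 3 × Fin n := ![(i, a), (j, b), (k, z), (i, a'), (j, b')]
  have hA : φ '' {0, 1, 2} = cell i j k a b z := image_triple φ _ _ _
  have hB : φ '' {1, 2, 3} = cell i j k a' b z := by
    rw [image_triple, ← cell_swap₁₂, ← cell_swap₂₃]; rfl
  have hD : φ '' {2, 3, 4} = cell i j k a' b' z := by
    rw [image_triple, ← cell_swap₂₃, ← cell_swap₁₂]; rfl
  refine h (hasRainbowCopy_of_rainbow rfl c φ ?_ ?_ ?_ ?_ ?_)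
  · intro x y hxy
    fin_cases x <;> fin_cases y <;> simp_all [φ]
  · rw [hA]; exact cell_mem hij hik hjk _ _ _
  · rw [hB]; exact cell_mem hij hik hjk _ _ _
  · rw [hD]; exact cell_mem hij hik hjk _ _ _
  · rwa [hA, hB, hD]

theorem not_rainbow_messy (h : ¬ HasRainbowCopy (completePartite 3 n) c messyPath)
    {i j k : Fin 3} (hij : i ≠ j) (hik : i ≠ k) (hjk : j ≠ k) {a a' b b' z z' : Fin n}
    (hb : b ≠ b') (hz : z ≠ z') :
    ¬ Rainbow (extend c (cell i j k a b z)) (extend c (cell i j k a' b z))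
      (extend c (cell i j k a' b' z')) := by
  intro hr
  have ha : a ≠ a' := by rintro rfl; exact hr.1 rfl
  let φ : Fin 6 → Fin 3 × Fin n := ![(i, a), (j, b), (k, z), (i, a'), (j, b'), (k, z')]
  have hA : φ '' {0, 1, 2} = cell i j k a b z := image_triple φ _ _ _
  have hB : φ '' {1, 2, 3} = cell i j k a' b z := by
    rw [image_triple, ← cell_swap₁₂, ← cell_swap₂₃]; rfl
  have hD : φ '' {3, 4, 5} = cell i j k a' b' z' := image_triple φ _ _ _
  refine h (hasRainbowCopy_of_rainbow rfl c φ ?_ ?_ ?_ ?_ ?_)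
  · intro x y hxy
    fin_cases x <;> fin_cases y <;> simp_all [φ]
  · rw [hA]; exact cell_mem hij hik hjk _ _ _
  · rw [hB]; exact cell_mem hij hik hjk _ _ _
  · rw [hD]; exact cell_mem hij hik hjk _ _ _
  · rwa [hA, hB, hD]

theorem not_rainbow_loose (h : ¬ HasRainbowCopy (completePartite 3 n) c loosePath)
    {i j k : Fin 3} (hij : i ≠ j) (hik : i ≠ k) (hjk : j ≠ k) {a a' b b' z z' z'' : Fin n}
    (ha : a ≠ a') (hb : b ≠ b') (hz : z ≠ z') (hz' : z ≠ z'') (hz'' : z' ≠ z'') :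
    ¬ Rainbow (extend c (cell i j k a b z)) (extend c (cell i j k a b' z'))
      (extend c (cell i j k a' b' z'')) := by
  intro hr
  -- The joints 2 and 4 lie in the parts `i` and `j`; each edge has its own vertex in the part `k`.
  let φ : Fin 7 → Fin 3 × Fin n :=
    ![(j, b), (k, z), (i, a), (k, z'), (j, b'), (i, a'), (k, z'')]
  have hA : φ '' {0, 1, 2} = cell i j k a b z := by
    rw [image_triple, ← cell_swap₁₂, ← cell_swap₂₃]; rfl
  have hB : φ '' {2, 3, 4} = cell i j k a b' z' := by
    rw [image_triple, ← cell_swap₂₃]; rfl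
  have hD : φ '' {4, 5, 6} = cell i j k a' b' z'' := by
    rw [image_triple, ← cell_swap₁₂]; rfl
  refine h (hasRainbowCopy_of_rainbow rfl c φ ?_ ?_ ?_ ?_ ?_)
  · intro x y hxy
    fin_cases x <;> fin_cases y <;> simp_all [φ]
  · rw [hA]; exact cell_mem hij hik hjk _ _ _
  · rw [hB]; exact cell_mem hij hik hjk _ _ _
  · rw [hD]; exact cell_mem hij hik hjk _ _ _
  · rwa [hA, hB, hD]

theorem noTight_of_not_hasRainbowCopy
    (h : ¬ HasRainbowCopy (completePartite 3 n) c tightPath) :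
    NoTight fun x y z => extend c (cell 0 1 2 x y z) := by
  refine ⟨fun z x x' y y' => ?_, fun y x x' z z' => ?_, fun x y y' z z' => ?_⟩
  · exact not_rainbow_tight h (by decide) (by decide) (by decide) _ _ _ _ _
  · simp only [← cell_swap₂₃ 0 1 2]
    exact not_rainbow_tight h (by decide) (by decide) (by decide) _ _ _ _ _
  · simp only [← cell_swap₁₂ 0 1 2, ← cell_swap₂₃ 1 0 2]
    exact not_rainbow_tight h (by decide) (by decide) (by decide) _ _ _ _ _

theorem noMessy_of_not_hasRainbowCopy
    (h : ¬ HasRainbowCopy (completePartite 3 n) c messyPath) :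
    NoMessy fun x y z => extend c (cell 0 1 2 x y z) := by
  refine ⟨fun x x' y y' z z' hy hz => ?_, fun x x' y y' z z' hy hz => ?_,
    fun x x' y y' z z' hy hz => ?_⟩
  · exact not_rainbow_messy h (by decide) (by decide) (by decide) hy hz
  · simp only [← cell_swap₁₂ 0 1 2]
    exact not_rainbow_messy h (by decide) (by decide) (by decide) hy hz
  · simp only [← cell_swap₂₃ 0 1 2, ← cell_swap₁₂ 0 2 1]
    exact not_rainbow_messy h (by decide) (by decide) (by decide) hy hz

theorem noLoose_of_not_hasRainbowCopy
    (h : ¬ HasRainbowCopy (completePartite 3 n) c loosePath) :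
    NoLoose fun x y z => extend c (cell 0 1 2 x y z) := by
  refine ⟨fun x x' y y' z z' z'' hx hy h₁ h₂ h₃ => ?_, fun x x' y y' z z' z'' hx hy h₁ h₂ h₃ => ?_,
    fun x x' y y' z z' z'' hx hy h₁ h₂ h₃ => ?_⟩
  · exact not_rainbow_loose h (by decide) (by decide) (by decide) hx hy h₁ h₂ h₃
  · simp only [← cell_swap₂₃ 0 1 2]
    exact not_rainbow_loose h (by decide) (by decide) (by decide) hx hy h₁ h₂ h₃
  · simp only [← cell_swap₁₂ 0 1 2, ← cell_swap₂₃ 1 0 2]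
    exact not_rainbow_loose h (by decide) (by decide) (by decide) hx hy h₁ h₂ h₃

end Bridge

/-! ### Extremal colourings -/

section LowerBound

variable {n : ℕ}

theorem cell_inj {a b c a' b' c' : Fin n} (h : cell 0 1 2 a b c = cell 0 1 2 a' b' c') :
    a = a' ∧ b = b' ∧ c = c' := by
  have h₀ : ((0 : Fin 3), a) ∈ cell 0 1 2 a' b' c' := h ▸ by simp [cell]
  have h₁ : ((1 : Fin 3), b) ∈ cell 0 1 2 a' b' c' := h ▸ by simp [cell]
  have h₂ : ((2 : Fin 3), c) ∈ cell 0 1 2 a' b' c' := h ▸ by simp [cell]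
  simp [cell] at h₀ h₁ h₂
  exact ⟨h₀, h₁, h₂⟩

theorem le_ncard_range {m : ℕ} (c : (completePartite 3 n).edgeSet → ℕ)
    (h : ∀ p < m, ∃ e, c e = p) : m ≤ (Set.range c).ncard := by
  have := Set.ncard_le_ncard (s := Set.Iio m) (t := Set.range c) (fun p hp => h p hp)
    (Set.finite_range c)
  simpa using this

theorem exists_noMessy_coloring (n : ℕ) : ∃ c : (completePartite 3 n).edgeSet → ℕ,
    n ≤ (Set.range c).ncard ∧ ¬ HasRainbowCopy (completePartite 3 n) c messyPath := by
  have hc : ∀ e : (completePartite 3 n).edgeSet, ∃ a : Fin n, ((0 : Fin 3), a) ∈ e.1 := by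
    rintro ⟨e, he⟩
    obtain ⟨a, b, c, rfl⟩ := exists_eq_cell he
    exact ⟨a, Or.inl rfl⟩
  choose x hx using hc
  have same : ∀ (e e' : (completePartite 3 n).edgeSet) (v : Fin 3 × Fin n), v.1 = 0 → v ∈ e.1 →
      v ∈ e'.1 → x e = x e' := fun e e' v hv h h' =>
    congrArg Prod.snd ((eq_of_mem_edge e.2 (hx e) h hv.symm).trans
      (eq_of_mem_edge e'.2 (hx e') h' hv.symm).symm)
  refine ⟨fun e => x e, le_ncard_range _ fun p hp => ?_, fun h => ?_⟩
  · let e : (completePartite 3 n).edgeSet :=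
      ⟨cell 0 1 2 ⟨p, hp⟩ ⟨p, hp⟩ ⟨p, hp⟩, cell_mem (by decide) (by decide) (by decide) _ _ _⟩
    have := eq_of_mem_edge e.2 (hx e) (w := ((0 : Fin 3), ⟨p, hp⟩)) (Or.inl rfl) rfl
    exact ⟨e, congrArg (fun v => (v.2 : ℕ)) this⟩
  · obtain ⟨φ, hφ, hA, hB, hD, hr⟩ := h.exists_rainbow rfl rfl
      (fun h => by simpa using (Set.ext_iff.1 h 0)) (fun h => by simpa using (Set.ext_iff.1 h 0))
      (fun h => by simpa using (Set.ext_iff.1 h 1))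
    obtain ⟨t, ht, hv⟩ := hx ⟨_, hB⟩
    have h₀ : (φ t).1 = 0 := by rw [hv]
    have mem : ∀ {S : Set (Fin 6)}, t ∈ S → φ t ∈ φ '' S := Set.mem_image_of_mem φ
    -- Each vertex of the middle edge lies in the first or the last edge, so the middle edge repeats
    -- a colour.
    rcases ht with rfl | rfl | rfl
    · exact hr.1 (congrArg _ (same ⟨_, hA⟩ ⟨_, hB⟩ _ h₀ (mem (by simp)) (mem (by simp))))
    · exact hr.1 (congrArg _ (same ⟨_, hA⟩ ⟨_, hB⟩ _ h₀ (mem (by simp)) (mem (by simp))))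
    · exact hr.2.2 (congrArg _ (same ⟨_, hB⟩ ⟨_, hD⟩ _ h₀ (mem (by simp)) (mem (by simp))))

/-- Giving distinct positive colours to a family of edges and `0` to all other edges. -/
theorem exists_coloring_of_family (E : Fin n → (completePartite 3 n).edgeSet)
    (hE : Function.Injective E) (e₀ : (completePartite 3 n).edgeSet) (he₀ : ∀ i, e₀ ≠ E i) :
    ∃ c : (completePartite 3 n).edgeSet → ℕ, n + 1 ≤ (Set.range c).ncard ∧
      ∀ e₁ e₂ e₃, Rainbow (c e₁) (c e₂) (c e₃) → ∃ i j, i ≠ j ∧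
        ((e₁ = E i ∧ e₂ = E j) ∨ (e₁ = E i ∧ e₃ = E j) ∨ (e₂ = E i ∧ e₃ = E j)) := by
  classical
  let c : (completePartite 3 n).edgeSet → ℕ := fun e =>
    if h : ∃ i, e = E i then h.choose + 1 else 0
  have c_fam : ∀ i, c (E i) = i + 1 := by
    intro i
    have h : ∃ j, E i = E j := ⟨i, rfl⟩
    have := hE h.choose_spec
    simp only [c, dif_pos h, ← this]
  have c_zero : ∀ e, c e = 0 ∨ ∃ i, e = E i := by
    intro e
    by_cases h : ∃ i, e = E i
    · exact Or.inr h
    · exact Or.inl (dif_neg h)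
  refine ⟨c, le_ncard_range c fun p hp => ?_, fun e₁ e₂ e₃ h => ?_⟩
  · rcases p with _ | p
    · exact ⟨e₀, dif_neg fun ⟨i, hi⟩ => he₀ i hi⟩
    · exact ⟨E ⟨p, by omega⟩, c_fam _⟩
  · obtain ⟨h₁, h₂, h₃⟩ := h
    rcases c_zero e₁ with z₁ | ⟨i, rfl⟩ <;> rcases c_zero e₂ with z₂ | ⟨j, rfl⟩
    · exact absurd (z₁.trans z₂.symm) h₁
    · rcases c_zero e₃ with z₃ | ⟨k, rfl⟩
      · exact absurd (z₁.trans z₃.symm) h₂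
      · exact ⟨j, k, fun h => h₃ (by rw [h]), Or.inr (Or.inr ⟨rfl, rfl⟩)⟩
    · rcases c_zero e₃ with z₃ | ⟨k, rfl⟩
      · exact absurd (z₂.trans z₃.symm) h₃
      · exact ⟨i, k, fun h => h₂ (by rw [h]), Or.inr (Or.inl ⟨rfl, rfl⟩)⟩
    · exact ⟨i, j, fun h => h₁ (by rw [h]), Or.inl ⟨rfl, rfl⟩⟩

/-- The diagonal edges are disjoint, while all three edges of a tight path contain its middle
vertex; so at most one of them is diagonal, but a rainbow copy needs two. -/
theorem exists_noTight_coloring (hn : 2 ≤ n) : ∃ c : (completePartite 3 n).edgeSet → ℕ,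
    n + 1 ≤ (Set.range c).ncard ∧ ¬ HasRainbowCopy (completePartite 3 n) c tightPath := by
  let E : Fin n → (completePartite 3 n).edgeSet := fun i =>
    ⟨cell 0 1 2 i i i, cell_mem (by decide) (by decide) (by decide) _ _ _⟩
  have disj : ∀ {i j v}, v ∈ (E i).1 → v ∈ (E j).1 → i = j := by
    intro i j v h h'
    have h₁ : v.2 = i := by rcases h with rfl | rfl | rfl <;> rfl
    have h₂ : v.2 = j := by rcases h' with rfl | rfl | rfl <;> rfl
    exact h₁.symm.trans h₂
  obtain ⟨c, hc, hr⟩ := exists_coloring_of_family E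
    (fun i j h => (cell_inj (congrArg Subtype.val h)).1)
    ⟨cell 0 1 2 ⟨0, by omega⟩ ⟨0, by omega⟩ ⟨1, by omega⟩,
      cell_mem (by decide) (by decide) (by decide) _ _ _⟩
    (fun i h => by
      have := cell_inj (congrArg Subtype.val h)
      simpa using this.2.1.trans this.2.2.symm)
  refine ⟨c, hc, fun h => ?_⟩
  obtain ⟨φ, hφ, hA, hB, hD, h⟩ := h.exists_rainbow rfl rfl
    (fun h => by simpa using (Set.ext_iff.1 h 0)) (fun h => by simpa using (Set.ext_iff.1 h 0))
    (fun h => by simpa using (Set.ext_iff.1 h 1))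
  have mem : ∀ {S : Set (Fin 5)}, 2 ∈ S → φ 2 ∈ φ '' S := Set.mem_image_of_mem φ
  have mA : φ 2 ∈ φ '' {0, 1, 2} := mem (by simp)
  have mB : φ 2 ∈ φ '' {1, 2, 3} := mem (by simp)
  have mD : φ 2 ∈ φ '' {2, 3, 4} := mem (by simp)
  obtain ⟨i, j, hij, ⟨h₁, h₂⟩ | ⟨h₁, h₂⟩ | ⟨h₁, h₂⟩⟩ := hr _ _ _ h
  · exact hij (disj ((Subtype.ext_iff.1 h₁).subset mA) ((Subtype.ext_iff.1 h₂).subset mB))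
  · exact hij (disj ((Subtype.ext_iff.1 h₁).subset mA) ((Subtype.ext_iff.1 h₂).subset mD))
  · exact hij (disj ((Subtype.ext_iff.1 h₁).subset mB) ((Subtype.ext_iff.1 h₂).subset mD))

/-- The special edges pairwise share two vertices, whereas two edges of a loose path share at most
one. -/
theorem exists_noLoose_coloring (hn : 2 ≤ n) : ∃ c : (completePartite 3 n).edgeSet → ℕ,
    n + 1 ≤ (Set.range c).ncard ∧ ¬ HasRainbowCopy (completePartite 3 n) c loosePath := by
  let o : Fin n := ⟨0, by omega⟩
  let E : Fin n → (completePartite 3 n).edgeSet := fun i =>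
    ⟨cell 0 1 2 i o o, cell_mem (by decide) (by decide) (by decide) _ _ _⟩
  obtain ⟨c, hc, hr⟩ := exists_coloring_of_family E
    (fun i j h => (cell_inj (congrArg Subtype.val h)).1)
    ⟨cell 0 1 2 o o ⟨1, by omega⟩, cell_mem (by decide) (by decide) (by decide) _ _ _⟩
    (fun i h => by simpa [o] using (cell_inj (congrArg Subtype.val h)).2.2)
  refine ⟨c, hc, fun h => ?_⟩
  obtain ⟨φ, hφ, hA, hB, hD, h⟩ := h.exists_rainbow rfl rfl
    (fun h => by simpa using (Set.ext_iff.1 h 0)) (fun h => by simpa using (Set.ext_iff.1 h 0))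
    (fun h => by simpa using (Set.ext_iff.1 h 2))
  have absurd_of : ∀ {i j} {S T : Set (Fin 7)}, φ '' S = (E i).1 → φ '' T = (E j).1 →
      (S ∩ T).Subsingleton → False := by
    intro i j S T hS hT hST
    have mem : ∀ v, v ∈ (E i).1 → v ∈ (E j).1 → ∃ t ∈ S ∩ T, φ t = v := by
      intro v hv hv'
      rw [← hS] at hv
      rw [← hT] at hv'
      obtain ⟨t, ht, rfl⟩ := hv
      exact ⟨t, ⟨ht, (hφ.mem_set_image).1 hv'⟩, rfl⟩
    obtain ⟨t, ht, h₁⟩ := mem (1, o) (by simp [E, cell]) (by simp [E, cell])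
    obtain ⟨t', ht', h₂⟩ := mem (2, o) (by simp [E, cell]) (by simp [E, cell])
    rw [hST ht ht', h₂] at h₁
    simpa using congrArg Prod.fst h₁
  obtain ⟨i, j, -, ⟨h₁, h₂⟩ | ⟨h₁, h₂⟩ | ⟨h₁, h₂⟩⟩ := hr _ _ _ h <;>
  · refine absurd_of (congrArg Subtype.val h₁) (congrArg Subtype.val h₂) ?_
    intro s hs t ht
    simp only [Set.mem_inter_iff, Set.mem_insert_iff, Set.mem_singleton_iff] at hs ht
    omega

end LowerBound

/-- Here `m` is the largest number of colours without rainbow copy, hence the successor. -/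
theorem isAntiRamseyNumber_succ {n m : ℕ} {β : Type*} {G : Hypergraph β}
    (upper : ∀ c : (completePartite 3 n).edgeSet → ℕ, ¬ HasRainbowCopy (completePartite 3 n) c G →
      (Set.range c).ncard ≤ m)
    (lower : ∃ c : (completePartite 3 n).edgeSet → ℕ,
      m ≤ (Set.range c).ncard ∧ ¬ HasRainbowCopy (completePartite 3 n) c G) :
    IsAntiRamseyNumber (completePartite 3 n) G (m + 1) := by
  refine ⟨fun c hc => ?_, fun k hk => ?_⟩
  · by_contra h
    have := upper c h
    omega
  · obtain ⟨c, hc, h⟩ := lower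
    by_contra hlt
    exact h (hk c (by omega))

theorem exists_ne_ne {n : ℕ} (hn : 3 ≤ n) (a b : Fin n) : ∃ c, c ≠ a ∧ c ≠ b := by
  have : ({a, b} : Finset (Fin n)).card < Fintype.card (Fin n) := by
    rw [Fintype.card_fin]
    exact Finset.card_le_two.trans_lt hn
  obtain ⟨c, -, hc⟩ := Finset.exists_mem_notMem_of_card_lt_card (t := Finset.univ) this
  exact ⟨c, by simpa using hc⟩

end AntiRamsey

theorem mainTheorem11 (n : ℕ) (hn : 3 ≤ n) :
    AntiRamsey.IsAntiRamseyNumber (AntiRamsey.completePartite 3 n) AntiRamsey.messyPath (n + 1) ∧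
    AntiRamsey.IsAntiRamseyNumber (AntiRamsey.completePartite 3 n) AntiRamsey.tightPath (n + 2) ∧
    AntiRamsey.IsAntiRamseyNumber (AntiRamsey.completePartite 3 n) AntiRamsey.loosePath (n + 2) := by
  have hα := AntiRamsey.exists_ne_ne hn
  have hcard : 3 ≤ Fintype.card (Fin n) := by simpa using hn
  refine ⟨AntiRamsey.isAntiRamseyNumber_succ (fun c h => ?_) (AntiRamsey.exists_noMessy_coloring n),
    AntiRamsey.isAntiRamseyNumber_succ (fun c h => ?_)
      (AntiRamsey.exists_noTight_coloring (by omega)),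
    AntiRamsey.isAntiRamseyNumber_succ (fun c h => ?_)
      (AntiRamsey.exists_noLoose_coloring (by omega))⟩
  · have := (AntiRamsey.noMessy_of_not_hasRainbowCopy h).ncard_colors_le hcard hα
    rwa [AntiRamsey.colors_extend, Fintype.card_fin] at this
  · have := (AntiRamsey.noTight_of_not_hasRainbowCopy h).ncard_colors_le
    rwa [AntiRamsey.colors_extend, Fintype.card_fin] at this
  · have := (AntiRamsey.noLoose_of_not_hasRainbowCopy h).ncard_colors_le hcard hα
    rwa [AntiRamsey.colors_extend, Fintype.card_fin] at this
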